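/- Let $M$ be a smooth manifold of dimension $3$ with an almost contact B-metric structure $(\varphi,\xi,\eta,g)$: $\varphi$ is a smooth field of endomorphisms of the tangent spaces, $\xi$ a smooth vector field, $\eta$ a smooth $1$-form and $g$ a smooth pseudo-Riemannian metric of signature $(2,1)$ such that, for all tangent vectors $x,y$ at the same point, $$\varphi\xi=0,\qquad \varphi^2x=-x+\eta(x)\xi,\qquad \eta(\varphi x)=0,\qquad \eta(\xi)=1,\qquad g(\varphi x,\varphi y)=-g(x,y)+\eta(x)\eta(y).$$ Let $\nabla$ be the Levi-Civita connection of $g$, $R(x,y)z=\nabla_x\nabla_yz-\nabla_y\nabla_xz-\nabla_{[x,y]}z$ its curvature tensor, $R(x,y,z,w)=g(R(x,y)z,w)$, and $\rho(y,z)=\operatorname{tr}\bigl(x\mapsto R(x,y)z\bigr)$ its Ricci tensor. Put $\tilde g(x,y)=g(x,\varphi y)+\eta(x)\eta(y)$. Assume that the manifold is Sasaki-like, i.e. $$(\nabla_x\varphi)y=-g(x,y)\xi-\eta(y)x+2\eta(x)\eta(y)\xi ,$$ and that it admits a Ricci-like soliton with potential $v$, i.e. $v$ is a smooth vector field on $M$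 and there are real constants $\lambda,\mu,\nu$ with $$\tfrac12\mathcal L_vg+\rho+\lambda g+\mu\tilde g+\nu\,\eta\otimes\eta=0 .$$ By a section at $p\in M$ we mean a $2$-plane $\beta\subset T_pM$ on which $g$ is nondegenerate. Its sectional curvature is $$k(\beta;p)=\frac{R(x,y,y,x)}{g(x,x)g(y,y)-g(x,y)^2}$$ for any basis $\{x,y\}$ of $\beta$. Then: (i) every $\varphi$-holomorphic section, i.e. every section $\beta$ with $\varphi\beta=\beta$, has sectional curvature $-1$; (ii) every $\xi$-section, i.e. every section with a basis of the form $\{x,\xi\}$, has sectional curvature $1$. -/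

import Mathlib

open Bundle FiberBundle VectorField
open scoped Manifold ContDiff

/-- A smooth pseudo-Riemannian metric on a manifold `M` modelled on the normed space `E`:
a smooth field of symmetric nondegenerate bilinear forms on the tangent spaces. -/
structure PseudoRiemannianMetric (E : Type*) [NormedAddCommGroup E] [NormedSpace ℝ E]
    (M : Type*) [TopologicalSpace M] [ChartedSpace E M] [IsManifold 𝓘(ℝ, E) ∞ M] where
  /-- The bilinear form on each tangent space. -/
  val : Π p : M, TangentSpace 𝓘(ℝ, E) p →L[ℝ] TangentSpace 𝓘(ℝ, E) p →L[ℝ] ℝ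
  symm : ∀ (p : M) (x y : TangentSpace 𝓘(ℝ, E) p), val p x y = val p y x
  nondegenerate : ∀ (p : M) (x : TangentSpace 𝓘(ℝ, E) p), (∀ y, val p x y = 0) → x = 0
  contMDiff : ContMDiff 𝓘(ℝ, E) (𝓘(ℝ, E).prod 𝓘(ℝ, E →L[ℝ] E →L[ℝ] ℝ)) ∞
    (fun p ↦ TotalSpace.mk' (E →L[ℝ] E →L[ℝ] ℝ)
      (E := fun p : M ↦ TangentSpace 𝓘(ℝ, E) p →L[ℝ] TangentSpace 𝓘(ℝ, E) p →L[ℝ] ℝ) p (val p))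

namespace PseudoRiemannianMetric

variable {E : Type*} [NormedAddCommGroup E] [NormedSpace ℝ E]
  {M : Type*} [TopologicalSpace M] [ChartedSpace E M] [IsManifold 𝓘(ℝ, E) ∞ M]

/-- The metric has signature `(r, s)`: every tangent space has an orthonormal basis with `r`
vectors of square `1` and `s` vectors of square `-1`. -/
def HasSignature (g : PseudoRiemannianMetric E M) (r s : ℕ) : Prop :=
  ∀ p : M, ∃ e : Module.Basis (Fin r ⊕ Fin s) ℝ (TangentSpace 𝓘(ℝ, E) p),
    (∀ i j, i ≠ j → g.val p (e i) (e j) = 0) ∧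
    (∀ i, g.val p (e (Sum.inl i)) (e (Sum.inl i)) = 1) ∧
    (∀ j, g.val p (e (Sum.inr j)) (e (Sum.inr j)) = -1)

/-! ### The Levi-Civita connection, from the Koszul formula -/

/-- Half of the right-hand side of the Koszul formula, i.e. the value that `g(∇_X Y, Z)` has at
the point `p`. -/
noncomputable def koszul (g : PseudoRiemannianMetric E M)
    (X Y Z : Π p : M, TangentSpace 𝓘(ℝ, E) p) (p : M) : ℝ :=
  (1 / 2) * (mvfderiv 𝓘(ℝ, E) (fun q ↦ g.val q (Y q) (Z q)) p (X p)
    + mvfderiv 𝓘(ℝ, E) (fun q ↦ g.val q (Z q) (X q)) p (Y p)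
    - mvfderiv 𝓘(ℝ, E) (fun q ↦ g.val q (X q) (Y q)) p (Z p)
    + g.val p (mlieBracket 𝓘(ℝ, E) X Y p) (Z p)
    - g.val p (mlieBracket 𝓘(ℝ, E) Y Z p) (X p)
    + g.val p (mlieBracket 𝓘(ℝ, E) Z X p) (Y p))

theorem mdifferentiableAt_val (g : PseudoRiemannianMetric E M)
    {X Y : Π p : M, TangentSpace 𝓘(ℝ, E) p} {p : M}
    (hX : MDiffAt (T% X) p) (hY : MDiffAt (T% Y) p) :
    MDiffAt (fun q ↦ g.val q (X q) (Y q)) p := by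
  have h := MDifferentiableAt.clm_bundle_apply₂ (F₁ := E) (F₂ := E) (F₃ := ℝ)
    (E₃ := Bundle.Trivial M ℝ) (b := fun q : M ↦ q)
    ((g.contMDiff p).mdifferentiableAt (by simp)) hX hY
  simp only [mdifferentiableAt_totalSpace] at h
  exact h.2

theorem eq_of_forall_val_eq (g : PseudoRiemannianMetric E M) {p : M}
    {x y : TangentSpace 𝓘(ℝ, E) p}
    (h : ∀ Z : Π p : M, TangentSpace 𝓘(ℝ, E) p, MDiffAt (T% Z) p →
      g.val p x (Z p) = g.val p y (Z p)) : x = y := by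
  refine sub_eq_zero.1 (g.nondegenerate p _ fun z ↦ ?_)
  have := h (extend E z) (mdifferentiableAt_extend ..)
  rw [extend_apply_self] at this
  simp [this]

variable [FiniteDimensional ℝ E]

theorem koszul_tensorial_left (g : PseudoRiemannianMetric E M)
    {Y Z : Π p : M, TangentSpace 𝓘(ℝ, E) p} {p : M}
    (hY : MDiffAt (T% Y) p) (hZ : MDiffAt (T% Z) p) :
    TensorialAt 𝓘(ℝ, E) E (fun X ↦ g.koszul X Y Z p) p where
  smul {f X} hf hX := by
    have : IsManifold 𝓘(ℝ, E) 2 M := IsManifold.of_le (n := ∞) (by norm_cast)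
    have h1 : mvfderiv 𝓘(ℝ, E) (fun q ↦ f q * g.val q (Z q) (X q)) p = _ :=
      mvfderiv_mul hf (g.mdifferentiableAt_val hZ hX)
    have h2 : mvfderiv 𝓘(ℝ, E) (fun q ↦ f q * g.val q (X q) (Y q)) p = _ :=
      mvfderiv_mul hf (g.mdifferentiableAt_val hX hY)
    simp only [koszul, Pi.smul_apply', map_smul, smul_apply, smul_eq_mul,
      h1, h2, mlieBracket_smul_left hf hX, mlieBracket_smul_right hf hX, map_add,
      add_apply, neg_smul, map_neg, neg_apply]
    rw [g.symm p (Z p) (X p)]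
    ring
  add {X X'} hX hX' := by
    have : IsManifold 𝓘(ℝ, E) 2 M := IsManifold.of_le (n := ∞) (by norm_cast)
    have h1 : mvfderiv 𝓘(ℝ, E) (fun q ↦ g.val q (Z q) (X q) + g.val q (Z q) (X' q)) p = _ :=
      mvfderiv_add (g.mdifferentiableAt_val hZ hX) (g.mdifferentiableAt_val hZ hX')
    have h2 : mvfderiv 𝓘(ℝ, E) (fun q ↦ g.val q (X q) (Y q) + g.val q (X' q) (Y q)) p = _ :=
      mvfderiv_add (g.mdifferentiableAt_val hX hY) (g.mdifferentiableAt_val hX' hY)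
    simp only [koszul, Pi.add_apply, map_add, add_apply,
      h1, h2, mlieBracket_add_left hX hX', mlieBracket_add_right hX hX']
    ring

theorem koszul_tensorial_right (g : PseudoRiemannianMetric E M)
    {X Y : Π p : M, TangentSpace 𝓘(ℝ, E) p} {p : M}
    (hX : MDiffAt (T% X) p) (hY : MDiffAt (T% Y) p) :
    TensorialAt 𝓘(ℝ, E) E (fun Z ↦ g.koszul X Y Z p) p where
  smul {f Z} hf hZ := by
    have : IsManifold 𝓘(ℝ, E) 2 M := IsManifold.of_le (n := ∞) (by norm_cast)
    have h1 : mvfderiv 𝓘(ℝ, E) (fun q ↦ f q * g.val q (Y q) (Z q)) p = _ :=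
      mvfderiv_mul hf (g.mdifferentiableAt_val hY hZ)
    have h2 : mvfderiv 𝓘(ℝ, E) (fun q ↦ f q * g.val q (Z q) (X q)) p = _ :=
      mvfderiv_mul hf (g.mdifferentiableAt_val hZ hX)
    simp only [koszul, Pi.smul_apply', map_smul, smul_apply, smul_eq_mul,
      h1, h2, mlieBracket_smul_left hf hZ, mlieBracket_smul_right hf hZ, map_add,
      add_apply, neg_smul, map_neg, neg_apply]
    rw [g.symm p (Y p) (Z p)]
    ring
  add {Z Z'} hZ hZ' := by
    have : IsManifold 𝓘(ℝ, E) 2 M := IsManifold.of_le (n := ∞) (by norm_cast)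
    have h1 : mvfderiv 𝓘(ℝ, E) (fun q ↦ g.val q (Y q) (Z q) + g.val q (Y q) (Z' q)) p = _ :=
      mvfderiv_add (g.mdifferentiableAt_val hY hZ) (g.mdifferentiableAt_val hY hZ')
    have h2 : mvfderiv 𝓘(ℝ, E) (fun q ↦ g.val q (Z q) (X q) + g.val q (Z' q) (X q)) p = _ :=
      mvfderiv_add (g.mdifferentiableAt_val hZ hX) (g.mdifferentiableAt_val hZ' hX)
    simp only [koszul, Pi.add_apply, map_add, add_apply,
      h1, h2, mlieBracket_add_left hZ hZ', mlieBracket_add_right hZ hZ']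
    ring

/-- The musical isomorphism `T_pM → (T_pM)^*`, `x ↦ g(x, ·)`. -/
noncomputable def flat (g : PseudoRiemannianMetric E M) (p : M) :
    TangentSpace 𝓘(ℝ, E) p ≃L[ℝ] (TangentSpace 𝓘(ℝ, E) p →L[ℝ] ℝ) :=
  haveI : FiniteDimensional ℝ (TangentSpace 𝓘(ℝ, E) p) := inferInstanceAs (FiniteDimensional ℝ E)
  haveI : T2Space (TangentSpace 𝓘(ℝ, E) p) := inferInstanceAs (T2Space E)
  (LinearMap.linearEquivOfInjective (g.val p : TangentSpace 𝓘(ℝ, E) p →ₗ[ℝ] _)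
    ((injective_iff_map_eq_zero _).2 fun x hx ↦ g.nondegenerate p x fun y ↦ by
      simpa using congrArg (fun f : TangentSpace 𝓘(ℝ, E) p →L[ℝ] ℝ ↦ f y) hx)
    (((LinearMap.toContinuousLinearMap (𝕜 := ℝ) (E := TangentSpace 𝓘(ℝ, E) p)
      (F' := ℝ)).finrank_eq.symm.trans Subspace.dual_finrank_eq).symm)).toContinuousLinearEquiv

theorem flat_apply (g : PseudoRiemannianMetric E M) (p : M) (x y : TangentSpace 𝓘(ℝ, E) p) :
    g.flat p x y = g.val p x y := rfl

open Classical in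
/-- The Levi-Civita connection as a function: `leviCivitaFun Y p x` is `(∇_x Y)(p)`, the vector
with `g(∇_X Y, Z)` equal to the Koszul expression for all `Z`; it is set to be `0` if `Y` is not
differentiable at `p`. -/
noncomputable def leviCivitaFun (g : PseudoRiemannianMetric E M)
    (Y : Π p : M, TangentSpace 𝓘(ℝ, E) p) (p : M) :
    TangentSpace 𝓘(ℝ, E) p →L[ℝ] TangentSpace 𝓘(ℝ, E) p :=
  if hY : MDiffAt (T% Y) p then
    (g.flat p).symm.toContinuousLinearMap ∘L
      TensorialAt.mkHom₂ (I := 𝓘(ℝ, E)) (F := E) (F' := E) (fun X Z ↦ g.koszul X Y Z p) p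
        (fun _ hZ ↦ g.koszul_tensorial_left hY hZ) (fun _ hX ↦ g.koszul_tensorial_right hX hY)
  else 0

theorem val_leviCivitaFun (g : PseudoRiemannianMetric E M)
    {X Y Z : Π p : M, TangentSpace 𝓘(ℝ, E) p} {p : M}
    (hX : MDiffAt (T% X) p) (hY : MDiffAt (T% Y) p) (hZ : MDiffAt (T% Z) p) :
    g.val p (g.leviCivitaFun Y p (X p)) (Z p) = g.koszul X Y Z p := by
  rw [← flat_apply, leviCivitaFun, dif_pos hY]
  simp only [ContinuousLinearMap.comp_apply]
  erw [ContinuousLinearEquiv.apply_symm_apply]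
  exact TensorialAt.mkHom₂_apply _ _ hX hZ

/-- The Levi-Civita connection of a pseudo-Riemannian metric. The argument order is that of
Mathlib: `g.leviCivita Y p x` is `(∇_x Y)(p)`. -/
noncomputable def leviCivita (g : PseudoRiemannianMetric E M) :
    CovariantDerivative 𝓘(ℝ, E) E (TangentSpace 𝓘(ℝ, E) : M → Type _) where
  toFun := g.leviCivitaFun
  isCovariantDerivativeOnUniv :=
    { add := by
        intro Y Y' p hY hY' _
        have : IsManifold 𝓘(ℝ, E) 2 M := IsManifold.of_le (n := ∞) (by norm_cast)
        ext x
        refine g.eq_of_forall_val_eq fun Z hZ ↦ ?_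
        have hX := mdifferentiableAt_extend 𝓘(ℝ, E) E x
        rw [← extend_apply_self E x, add_apply, map_add,
          add_apply,
          g.val_leviCivitaFun hX (mdifferentiableAt_add_section hY hY') hZ,
          g.val_leviCivitaFun hX hY hZ, g.val_leviCivitaFun hX hY' hZ]
        have h1 : mvfderiv 𝓘(ℝ, E) (fun q ↦ g.val q (Y q) (Z q) + g.val q (Y' q) (Z q)) p = _ :=
          mvfderiv_add (g.mdifferentiableAt_val hY hZ) (g.mdifferentiableAt_val hY' hZ)
        have h2 : mvfderiv 𝓘(ℝ, E) (fun q ↦ g.val q (extend E x q) (Y q)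
            + g.val q (extend E x q) (Y' q)) p = _ :=
          mvfderiv_add (g.mdifferentiableAt_val hX hY) (g.mdifferentiableAt_val hX hY')
        simp only [koszul, Pi.add_apply, map_add, add_apply,
          h1, h2, mlieBracket_add_left hY hY', mlieBracket_add_right hY hY']
        ring
      leibniz := by
        intro Y f p hY hf _
        have : IsManifold 𝓘(ℝ, E) 2 M := IsManifold.of_le (n := ∞) (by norm_cast)
        ext x
        refine g.eq_of_forall_val_eq fun Z hZ ↦ ?_
        have hX := mdifferentiableAt_extend 𝓘(ℝ, E) E x
        have hfY : MDiffAt (T% (f • Y)) p := hf.smul_section hY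
        rw [← extend_apply_self E x, add_apply, map_add,
          add_apply, smul_apply, map_smul,
          smul_apply,
          g.val_leviCivitaFun hX hfY hZ, g.val_leviCivitaFun hX hY hZ]
        have h1 : mvfderiv 𝓘(ℝ, E) (fun q ↦ f q * g.val q (Y q) (Z q)) p = _ :=
          mvfderiv_mul hf (g.mdifferentiableAt_val hY hZ)
        have h2 : mvfderiv 𝓘(ℝ, E) (fun q ↦ f q * g.val q (extend E x q) (Y q)) p = _ :=
          mvfderiv_mul hf (g.mdifferentiableAt_val hX hY)
        simp only [koszul, Pi.smul_apply', map_smul, smul_apply, smul_eq_mul,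
          h1, h2, mlieBracket_smul_left hf hY, mlieBracket_smul_right hf hY, map_add,
          add_apply, neg_smul, map_neg, neg_apply,
          ContinuousLinearMap.smulRight_apply]
        rw [g.symm p (Y p) (extend E x p)]
        ring }

/-- The Levi-Civita connection is torsion-free. -/
theorem leviCivita_torsion (g : PseudoRiemannianMetric E M)
    {X Y : Π p : M, TangentSpace 𝓘(ℝ, E) p} {p : M}
    (hX : MDiffAt (T% X) p) (hY : MDiffAt (T% Y) p) :
    g.leviCivita Y p (X p) - g.leviCivita X p (Y p) = mlieBracket 𝓘(ℝ, E) X Y p := by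
  have e : ∀ U V : Π p : M, TangentSpace 𝓘(ℝ, E) p,
      (fun q ↦ g.val q (U q) (V q)) = fun q ↦ g.val q (V q) (U q) :=
    fun U V ↦ funext fun q ↦ g.symm q _ _
  refine g.eq_of_forall_val_eq fun Z hZ ↦ ?_
  rw [map_sub, sub_apply]
  erw [g.val_leviCivitaFun hX hY hZ, g.val_leviCivitaFun hY hX hZ]
  rw [koszul, koszul, mlieBracket_swap_apply (V := Y) (W := X),
    mlieBracket_swap_apply (V := X) (W := Z), mlieBracket_swap_apply (V := Z) (W := Y),
    e X Z, e Z Y, e Y X]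
  simp only [map_neg, neg_apply]
  ring

/-- The Levi-Civita connection is compatible with the metric. -/
theorem leviCivita_metric (g : PseudoRiemannianMetric E M)
    {X Y Z : Π p : M, TangentSpace 𝓘(ℝ, E) p} {p : M}
    (hX : MDiffAt (T% X) p) (hY : MDiffAt (T% Y) p) (hZ : MDiffAt (T% Z) p) :
    mvfderiv 𝓘(ℝ, E) (fun q ↦ g.val q (Y q) (Z q)) p (X p)
      = g.val p (g.leviCivita Y p (X p)) (Z p) + g.val p (Y p) (g.leviCivita Z p (X p)) := by
  have e : ∀ U V : Π p : M, TangentSpace 𝓘(ℝ, E) p,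
      (fun q ↦ g.val q (U q) (V q)) = fun q ↦ g.val q (V q) (U q) :=
    fun U V ↦ funext fun q ↦ g.symm q _ _
  rw [g.symm p (Y p)]
  erw [g.val_leviCivitaFun hX hY hZ, g.val_leviCivitaFun hX hZ hY]
  rw [koszul, koszul, mlieBracket_swap_apply (V := X) (W := Z),
    mlieBracket_swap_apply (V := Z) (W := Y), mlieBracket_swap_apply (V := Y) (W := X),
    e Z Y, e Y X, e X Z]
  simp only [map_neg, neg_apply]
  ring

/-! ### Curvature, Ricci tensor, Lie derivative of the metric, covariant derivative of a
field of endomorphisms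

The tensors below are computed at a point `p` from vector fields which extend the given tangent
vectors at `p`; `extend E x` is Mathlib's extension of `x` to a vector field which is smooth in a
neighbourhood of the base point of `x`. -/

/-- `R(X, Y)Z = ∇_X ∇_Y Z - ∇_Y ∇_X Z - ∇_[X, Y] Z` for vector fields, at the point `p`. -/
noncomputable def curvatureField (g : PseudoRiemannianMetric E M)
    (X Y Z : Π p : M, TangentSpace 𝓘(ℝ, E) p) (p : M) : TangentSpace 𝓘(ℝ, E) p :=
  g.leviCivita (fun q ↦ g.leviCivita Z q (Y q)) p (X p)
    - g.leviCivita (fun q ↦ g.leviCivita Z q (X q)) p (Y p)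
    - g.leviCivita Z p (mlieBracket 𝓘(ℝ, E) X Y p)

/-- The curvature tensor `R(x, y)z` at the point `p`. -/
noncomputable def curvature (g : PseudoRiemannianMetric E M) (p : M)
    (x y z : TangentSpace 𝓘(ℝ, E) p) : TangentSpace 𝓘(ℝ, E) p :=
  g.curvatureField (extend E x) (extend E y) (extend E z) p

/-- The curvature tensor of type `(0, 4)`, `R(x, y, z, w) = g(R(x, y)z, w)`. -/
noncomputable def curvature₄ (g : PseudoRiemannianMetric E M) (p : M)
    (x y z w : TangentSpace 𝓘(ℝ, E) p) : ℝ :=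
  g.val p (g.curvature p x y z) w

/-- The Ricci tensor `ρ(y, z)`, the trace of `x ↦ R(x, y)z`. -/
noncomputable def ricci (g : PseudoRiemannianMetric E M) (p : M)
    (y z : TangentSpace 𝓘(ℝ, E) p) : ℝ :=
  letI b : Module.Basis (Fin (Module.finrank ℝ E)) ℝ (TangentSpace 𝓘(ℝ, E) p) :=
    Module.finBasis ℝ E
  ∑ i, b.repr (g.curvature p (b i) y z) i

/-- The Lie derivative of the metric along the vector field `v`,
`(𝓛_v g)(x, y) = v(g(X, Y)) - g([v, X], Y) - g(X, [v, Y])`. -/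
noncomputable def lieDerivative (g : PseudoRiemannianMetric E M)
    (v : Π p : M, TangentSpace 𝓘(ℝ, E) p) (p : M) (x y : TangentSpace 𝓘(ℝ, E) p) : ℝ :=
  mvfderiv 𝓘(ℝ, E) (fun q ↦ g.val q (extend E x q) (extend E y q)) p (v p)
    - g.val p (mlieBracket 𝓘(ℝ, E) v (extend E x) p) y
    - g.val p x (mlieBracket 𝓘(ℝ, E) v (extend E y) p)

/-- The covariant derivative `(∇_x A)y = ∇_x(A Y) - A(∇_x Y)` of a field of endomorphisms. -/
noncomputable def covDerivEnd (g : PseudoRiemannianMetric E M)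
    (A : Π p : M, TangentSpace 𝓘(ℝ, E) p →L[ℝ] TangentSpace 𝓘(ℝ, E) p) (p : M)
    (x y : TangentSpace 𝓘(ℝ, E) p) : TangentSpace 𝓘(ℝ, E) p :=
  g.leviCivita (fun q ↦ A q (extend E y q)) p x - A p (g.leviCivita (extend E y) p x)

/-! ### Sectional curvature -/

/-- A section at `p`: a `2`-plane in `T_pM` on which the metric is nondegenerate. -/
def IsSection (g : PseudoRiemannianMetric E M) (p : M)
    (β : Submodule ℝ (TangentSpace 𝓘(ℝ, E) p)) : Prop :=
  Module.finrank ℝ β = 2 ∧ ∀ x ∈ β, (∀ y ∈ β, g.val p x y = 0) → x = 0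

/-- The sectional curvature at `p` of the plane with basis `x, y`. -/
noncomputable def sectionalCurvature (g : PseudoRiemannianMetric E M) (p : M)
    (x y : TangentSpace 𝓘(ℝ, E) p) : ℝ :=
  g.curvature₄ p x y y x / (g.val p x x * g.val p y y - g.val p x y ^ 2)

/-- The section `β` has sectional curvature `k`, whichever basis is used to compute it. -/
def HasSectionalCurvature (g : PseudoRiemannianMetric E M) (p : M)
    (β : Submodule ℝ (TangentSpace 𝓘(ℝ, E) p)) (k : ℝ) : Prop :=
  ∀ x y : TangentSpace 𝓘(ℝ, E) p, LinearIndependent ℝ ![x, y] → Submodule.span ℝ {x, y} = β →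
    g.sectionalCurvature p x y = k

end PseudoRiemannianMetric

/-- An almost contact B-metric structure `(φ, ξ, η, g)` on a manifold of dimension `2n + 1`. -/
structure AlmostContactBMetric (n : ℕ) (E : Type*) [NormedAddCommGroup E] [NormedSpace ℝ E]
    (M : Type*) [TopologicalSpace M] [ChartedSpace E M] [IsManifold 𝓘(ℝ, E) ∞ M] where
  /-- The field of endomorphisms `φ`. -/
  phi : Π p : M, TangentSpace 𝓘(ℝ, E) p →L[ℝ] TangentSpace 𝓘(ℝ, E) p
  /-- The Reeb vector field `ξ`. -/
  xi : Π p : M, TangentSpace 𝓘(ℝ, E) p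
  /-- The contact 1-form `η`. -/
  eta : Π p : M, TangentSpace 𝓘(ℝ, E) p →L[ℝ] ℝ
  /-- The B-metric `g`. -/
  g : PseudoRiemannianMetric E M
  contMDiff_phi : ContMDiff 𝓘(ℝ, E) (𝓘(ℝ, E).prod 𝓘(ℝ, E →L[ℝ] E)) ∞
    (fun p ↦ TotalSpace.mk' (E →L[ℝ] E)
      (E := fun p : M ↦ TangentSpace 𝓘(ℝ, E) p →L[ℝ] TangentSpace 𝓘(ℝ, E) p) p (phi p))
  contMDiff_xi : ContMDiff 𝓘(ℝ, E) (𝓘(ℝ, E).prod 𝓘(ℝ, E)) ∞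
    (fun p ↦ TotalSpace.mk' E (E := fun p : M ↦ TangentSpace 𝓘(ℝ, E) p) p (xi p))
  contMDiff_eta : ContMDiff 𝓘(ℝ, E) (𝓘(ℝ, E).prod 𝓘(ℝ, E →L[ℝ] ℝ)) ∞
    (fun p ↦ TotalSpace.mk' (E →L[ℝ] ℝ)
      (E := fun p : M ↦ TangentSpace 𝓘(ℝ, E) p →L[ℝ] ℝ) p (eta p))
  signature : g.HasSignature (n + 1) n
  phi_xi : ∀ p, phi p (xi p) = 0
  phi_phi : ∀ p x, phi p (phi p x) = -x + eta p x • xi p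
  eta_phi : ∀ p x, eta p (phi p x) = 0
  eta_xi : ∀ p, eta p (xi p) = 1
  g_phi_phi : ∀ p x y, g.val p (phi p x) (phi p y) = -g.val p x y + eta p x * eta p y

namespace AlmostContactBMetric

variable {n : ℕ} {E : Type*} [NormedAddCommGroup E] [NormedSpace ℝ E]
  {M : Type*} [TopologicalSpace M] [ChartedSpace E M] [IsManifold 𝓘(ℝ, E) ∞ M]

/-- The associated B-metric `g̃(x, y) = g(x, φy) + η(x)η(y)`. -/
noncomputable def gTilde (S : AlmostContactBMetric n E M) (p : M)
    (x y : TangentSpace 𝓘(ℝ, E) p) : ℝ :=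
  S.g.val p x (S.phi p y) + S.eta p x * S.eta p y

/-- `(∇_x φ)y = -g(x, y)ξ - η(y)x + 2η(x)η(y)ξ`. -/
def IsSasakiLike [FiniteDimensional ℝ E] (S : AlmostContactBMetric n E M) : Prop :=
  ∀ (p : M) (x y : TangentSpace 𝓘(ℝ, E) p),
    S.g.covDerivEnd S.phi p x y
      = -(S.g.val p x y • S.xi p) - S.eta p y • x + (2 * S.eta p x * S.eta p y) • S.xi p

/-- The manifold admits a Ricci-like soliton with potential vector field `v`:
`½ 𝓛_v g + ρ + λ g + μ g̃ + ν η ⊗ η = 0` for some constants `λ, μ, ν`. -/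
def AdmitsRicciLikeSoliton [FiniteDimensional ℝ E] (S : AlmostContactBMetric n E M)
    (v : Π p : M, TangentSpace 𝓘(ℝ, E) p) : Prop :=
  ∃ lam mu nu : ℝ, ∀ (p : M) (x y : TangentSpace 𝓘(ℝ, E) p),
    (1 / 2) * S.g.lieDerivative v p x y + S.g.ricci p x y + lam * S.g.val p x y
      + mu * S.gTilde p x y + nu * (S.eta p x * S.eta p y) = 0

/-- The section `β` at `p` is `φ`-holomorphic: `φβ = β`. -/
def IsPhiHolomorphic (S : AlmostContactBMetric n E M) (p : M)
    (β : Submodule ℝ (TangentSpace 𝓘(ℝ, E) p)) : Prop :=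
  β.map (S.phi p : TangentSpace 𝓘(ℝ, E) p →ₗ[ℝ] TangentSpace 𝓘(ℝ, E) p) = β

/-- The section `β` at `p` is a `ξ`-section: it has a basis of the form `x, ξ`. -/
def IsXiSection (S : AlmostContactBMetric n E M) (p : M)
    (β : Submodule ℝ (TangentSpace 𝓘(ℝ, E) p)) : Prop :=
  ∃ x : TangentSpace 𝓘(ℝ, E) p,
    LinearIndependent ℝ ![x, S.xi p] ∧ Submodule.span ℝ {x, S.xi p} = β

end AlmostContactBMetric

/-!
Two facts about the curvature operator `A = R(x, y)` of a Sasaki-like structure give the theorem;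
both come from computing with smooth local fields.

* `A` is skew for `g` (`PseudoRiemannianMetric.val_curvature_skew`). As `∇` is metric, this is the
  statement that `XYf - YXf = [X, Y]f` for `f = g(Z, W)`. It also makes `R(X, Y)Z` tensorial in `Z`
  at once: in `g(R(X, Y)Z, W) = -g(Z, R(X, Y)W)` the right-hand side only involves the value of `Z`
  at the point. So `A φz` may be computed from the field `φZ`, although `φZ` is not the standard
  extension of the vector `φz`.
* The Sasaki-like identity gives `∇_x ξ = -φx`, hence `A ξ = η(y) x - η(x) y`
  (`AlmostContactBMetric.IsSasakiLike.curvature_xi`). Differentiating the Sasaki-like identity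
  once more gives, for `x, y, z` in `ker η`,
  `A φz = φ A z + g(y, z) φx - g(x, z) φy + g(z, φx) y - g(z, φy) x`
  (`AlmostContactBMetric.IsSasakiLike.curvature_phi`).

Let `x, y` be a basis of the section, `s = g(A y, x)` and `D = g(x, x) g(y, y) - g(x, y) ^ 2`.

For a `ξ`-section write `ξ = a x + b y`. Pairing the formula for `A ξ` with `x` and with `y` gives
`b s = b D` and `a s = a D`, so `s = D`.

A `φ`-holomorphic section is horizontal because `η ∘ φ = 0`. Write `φx = a x + b y`, where `b ≠ 0`
since `φ ^ 2 = -1` on the section has no real eigenvalue. The formula for `A φx` paired with `x`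
gives `2 b s = -2 b D`, so `s = -D`.

Most of the analysis is the proof that `∇_X Y` is differentiable for `C^2` fields `X` and `Y`, which
the second covariant derivatives need.
-/

/-! ### Regularity of the Levi-Civita connection -/

/-- Regularity at a point spreads to a neighbourhood: second covariant derivatives need first-order
identities near the point, not just at it. -/
theorem ContMDiffAt.eventually_mdifferentiableAt {E : Type*} [NormedAddCommGroup E]
    [NormedSpace ℝ E] {M : Type*} [TopologicalSpace M] [ChartedSpace E M] [IsManifold 𝓘(ℝ, E) ∞ M]
    {X : Π p : M, TangentSpace 𝓘(ℝ, E) p} {p : M} (hX : CMDiffAt 2 (T% X) p) :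
    ∀ᶠ q in nhds p, MDiffAt (T% X) q := by
  have : IsManifold 𝓘(ℝ, E) 2 M := IsManifold.of_le (n := ∞) (by norm_cast)
  have : IsManifold 𝓘(ℝ, E) (1 + 1) M := IsManifold.of_le (n := ∞) (by norm_cast)
  have h : CMDiffAt 1 (T% X) p := hX.of_le (by norm_num)
  rw [contMDiffAt_iff_contMDiffAt_nhds (by simp)] at h
  exact h.mono fun q hq ↦ hq.mdifferentiableAt (by norm_num)

theorem mvfderiv_congr_of_eventuallyEq {E : Type*} [NormedAddCommGroup E] [NormedSpace ℝ E]
    {M : Type*} [TopologicalSpace M] [ChartedSpace E M] {f f' : M → ℝ} {p : M}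
    (h : f =ᶠ[nhds p] f') :
    mvfderiv 𝓘(ℝ, E) f p = mvfderiv 𝓘(ℝ, E) f' p := by
  ext x
  exact congrArg (fun L : E →L[ℝ] ℝ ↦ L x) h.mfderiv_eq

namespace PseudoRiemannianMetric

variable {E : Type*} [NormedAddCommGroup E] [NormedSpace ℝ E]
  {M : Type*} [TopologicalSpace M] [ChartedSpace E M] [IsManifold 𝓘(ℝ, E) ∞ M]

theorem contMDiffAt_val (g : PseudoRiemannianMetric E M) {n : ℕ∞}
    {X Y : Π p : M, TangentSpace 𝓘(ℝ, E) p} {p : M}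
    (hX : CMDiffAt n (T% X) p) (hY : CMDiffAt n (T% Y) p) :
    CMDiffAt n (fun q ↦ g.val q (X q) (Y q)) p := by
  have h := ContMDiffAt.clm_bundle_apply₂ (F₁ := E) (F₂ := E) (F₃ := ℝ)
    (E₃ := Bundle.Trivial M ℝ) (b := fun q : M ↦ q)
    ((g.contMDiff p).of_le (by exact_mod_cast le_top)) hX hY
  simp only [contMDiffAt_totalSpace] at h
  exact h.2

theorem mdifferentiableAt_mvfderiv_apply {f : M → ℝ} {Y : Π p : M, TangentSpace 𝓘(ℝ, E) p} {p : M}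
    (hf : CMDiffAt 2 f p) (hY : CMDiffAt 1 (T% Y) p) :
    MDiffAt (fun q ↦ mvfderiv 𝓘(ℝ, E) f q (Y q)) p := by
  have : IsManifold 𝓘(ℝ, E) 1 M := IsManifold.of_le (n := ∞) (by norm_cast)
  have h := ContMDiffAt.clm_apply_of_inCoordinates (b₁ := fun q : M ↦ q) (b₂ := f) (v := Y)
    (ContMDiffAt.mfderiv_const (m := 1) hf (by norm_num)) hY (hf.of_le (by norm_num))
  have := contMDiffAt_totalSpace.1 h
  simpa [mvfderiv] using! this.2.mdifferentiableAt (by norm_num)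

variable [FiniteDimensional ℝ E]

theorem mdifferentiableAt_koszul (g : PseudoRiemannianMetric E M)
    {X Y Z : Π p : M, TangentSpace 𝓘(ℝ, E) p} {p : M}
    (hX : CMDiffAt 2 (T% X) p) (hY : CMDiffAt 2 (T% Y) p) (hZ : CMDiffAt 2 (T% Z) p) :
    MDiffAt (g.koszul X Y Z) p := by
  have : IsManifold 𝓘(ℝ, E) ((2 : ℕ∞) + 1) M := IsManifold.of_le (n := ∞) (by norm_cast)
  have : IsManifold 𝓘(ℝ, E) (minSmoothness ℝ 2) M := IsManifold.of_le (n := ∞) (by simp; norm_cast)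
  have D {U V W : Π p : M, TangentSpace 𝓘(ℝ, E) p} (hU : CMDiffAt 2 (T% U) p)
      (hV : CMDiffAt 2 (T% V) p) (hW : CMDiffAt 2 (T% W) p) :
      MDiffAt (fun q ↦ mvfderiv 𝓘(ℝ, E) (fun q ↦ g.val q (U q) (V q)) q (W q)) p :=
    mdifferentiableAt_mvfderiv_apply (g.contMDiffAt_val (n := 2) hU hV) (hW.of_le (by norm_num))
  have B {U V W : Π p : M, TangentSpace 𝓘(ℝ, E) p} (hU : CMDiffAt 2 (T% U) p)
      (hV : CMDiffAt 2 (T% V) p) (hW : CMDiffAt 2 (T% W) p) :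
      MDiffAt (fun q ↦ g.val q (mlieBracket 𝓘(ℝ, E) U V q) (W q)) p :=
    g.mdifferentiableAt_val
      ((ContMDiffAt.mlieBracket_vectorField (m := 1) (n := 2) hU hV
        (by simp; norm_num)).mdifferentiableAt (by norm_num))
      (hW.mdifferentiableAt (by norm_num))
  exact mdifferentiableAt_const.mul
    ((((((D hY hZ hX).add (D hZ hX hY)).sub (D hX hY hZ)).add (B hX hY hZ)).sub
      (B hY hZ hX)).add (B hZ hX hY))

open ContinuousLinearMap in
/-- A vector field is differentiable as soon as its products with the standard local fields are:
in a trivialization it is the inverse of the Gram operator, applied to the covector of products. -/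
theorem mdifferentiableAt_of_val_extend (g : PseudoRiemannianMetric E M)
    {V : Π p : M, TangentSpace 𝓘(ℝ, E) p} {p : M}
    (h : ∀ z : TangentSpace 𝓘(ℝ, E) p, MDiffAt (fun q ↦ g.val q (V q) (extend E z q)) p) :
    MDiffAt (T% V) p := by
  set e := trivializationAt E (TangentSpace 𝓘(ℝ, E) : M → Type _) p with he
  have hp : p ∈ e.baseSet := mem_baseSet_trivializationAt' p
  -- `G` is the metric read in the trivialization
  let G : M → E →L[ℝ] E →L[ℝ] ℝ := fun q ↦
    ContinuousLinearMap.inCoordinates E (TangentSpace 𝓘(ℝ, E) : M → Type _) (E →L[ℝ] ℝ)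
      (fun p : M ↦ TangentSpace 𝓘(ℝ, E) p →L[ℝ] ℝ) p q p q (g.val q)
  have hG : MDiffAt G p :=
    ((contMDiffAt_hom_bundle _).1 (g.contMDiff p)).2.mdifferentiableAt (by simp)
  have hGapp : ∀ q ∈ e.baseSet, ∀ x c : E, G q x c = g.val q (e.symm q x) (e.symm q c) := by
    intro q hq x c
    simpa using! inCoordinates_apply_eq₂ (E₃ := Bundle.Trivial M ℝ) (F₃ := ℝ) (ϕ := g.val q)
      (v := x) (w := c) hq hq (Set.mem_univ _)
  have hω : MDiffAt (fun q ↦ G q (e ⟨q, V q⟩).2) p := by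
    let b := Module.finBasis ℝ E
    have hb : ∀ i, MDiffAt (fun q ↦ G q (e ⟨q, V q⟩).2 (b i)) p := by
      intro i
      refine (h (e.symm p (b i))).congr_of_eventuallyEq ?_
      filter_upwards [e.open_baseSet.mem_nhds hp] with q hq
      rw [hGapp q hq]
      simp [FiberBundle.extend, ← he, hp, e.symm_apply_apply_mk hq]
    have : (fun q ↦ G q (e ⟨q, V q⟩).2)
        = ∑ i, fun q ↦ G q (e ⟨q, V q⟩).2 (b i) • LinearMap.toContinuousLinearMap (b.coord i) := by
      ext q x
      conv_lhs => rw [← b.sum_repr x, map_sum]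
      simp [mul_comm]
    rw [this]
    exact MDifferentiableAt.sum fun i _ ↦ (hb i).smul mdifferentiableAt_const
  -- nondegeneracy makes the metric read in the trivialization invertible
  have hinv : ∀ q ∈ e.baseSet, (G q).IsInvertible := by
    intro q hq
    simp only [G]
    rw [inCoordinates_eq hq (by exact ⟨hq, Set.mem_univ _⟩)]
    have h2 : (g.val q).IsInvertible := ⟨g.flat q, rfl⟩
    exact (isInvertible_equiv).comp (h2.comp isInvertible_equiv)
  have h1 : MDiffAt (fun q ↦ (G q).inverse (G q (e ⟨q, V q⟩).2)) p := by
    refine MDifferentiableAt.clm_apply ?_ hω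
    exact (((hinv p hp).contDiffAt_map_inverse (n := 1)).differentiableAt
      (by norm_num)).comp_mdifferentiableAt hG
  rw [e.mdifferentiableAt_section_iff _ _ hp]
  refine h1.congr_of_eventuallyEq ?_
  filter_upwards [e.open_baseSet.mem_nhds hp] with q hq
  exact ((hinv q hq).inverse_apply_self _).symm

theorem mdifferentiableAt_leviCivita (g : PseudoRiemannianMetric E M)
    {X Y : Π p : M, TangentSpace 𝓘(ℝ, E) p} {p : M}
    (hX : CMDiffAt 2 (T% X) p) (hY : CMDiffAt 2 (T% Y) p) :
    MDiffAt (T% (fun q ↦ g.leviCivita Y q (X q))) p := by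
  have : IsManifold 𝓘(ℝ, E) 2 M := IsManifold.of_le (n := ∞) (by norm_cast)
  refine g.mdifferentiableAt_of_val_extend fun z ↦ ?_
  have hz : CMDiffAt 2 (T% (extend E z)) p := contMDiffAt_extend ..
  refine (g.mdifferentiableAt_koszul hX hY hz).congr_of_eventuallyEq ?_
  filter_upwards [hX.eventually_mdifferentiableAt, hY.eventually_mdifferentiableAt,
    hz.eventually_mdifferentiableAt] with q h1 h2 h3
  exact g.val_leviCivitaFun h1 h2 h3

/-! ### Symmetries of the curvature tensor -/

/-- `[X, Y]f = XYf - YXf`, deduced from the Jacobi identity: for any field `Z`, the coefficient of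
`Z` in `[X, [Y, fZ]] - [Y, [X, fZ]] - [[X, Y], fZ] = 0` is `XYf - YXf - [X, Y]f`. -/
theorem mvfderiv_mlieBracket {f : M → ℝ} {X Y : Π p : M, TangentSpace 𝓘(ℝ, E) p} {p : M}
    (hf : CMDiffAt 2 f p) (hX : CMDiffAt 2 (T% X) p) (hY : CMDiffAt 2 (T% Y) p) :
    mvfderiv 𝓘(ℝ, E) f p (mlieBracket 𝓘(ℝ, E) X Y p)
      = mvfderiv 𝓘(ℝ, E) (fun q ↦ mvfderiv 𝓘(ℝ, E) f q (Y q)) p (X p)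
        - mvfderiv 𝓘(ℝ, E) (fun q ↦ mvfderiv 𝓘(ℝ, E) f q (X q)) p (Y p) := by
  -- the test field has to be nonzero at `p`, which is possible unless `T_pM` is trivial
  by_cases h0 : ∀ z : TangentSpace 𝓘(ℝ, E) p, z = 0
  · simp [h0 (X p), h0 (Y p), h0 (mlieBracket 𝓘(ℝ, E) X Y p)]
  push Not at h0
  obtain ⟨z, hz⟩ := h0
  let Z := extend E z
  have hZ : CMDiffAt 2 (T% Z) p := contMDiffAt_extend ..
  have hZp : Z p ≠ 0 := by simpa [Z] using hz
  have : IsManifold 𝓘(ℝ, E) 2 M := IsManifold.of_le (n := ∞) (by norm_cast)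
  have : IsManifold 𝓘(ℝ, E) ((2 : ℕ∞) + 1) M := IsManifold.of_le (n := ∞) (by norm_cast)
  have : IsManifold 𝓘(ℝ, E) (minSmoothness ℝ 2) M := IsManifold.of_le (n := ∞) (by simp; norm_cast)
  have : IsManifold 𝓘(ℝ, E) (minSmoothness ℝ 3) M := IsManifold.of_le (n := ∞) (by simp; norm_cast)
  have hf' : ∀ᶠ q in nhds p, MDiffAt f q := by
    have h : CMDiffAt 1 f p := hf.of_le (by norm_num)
    have : IsManifold 𝓘(ℝ, E) 1 M := IsManifold.of_le (n := ∞) (by norm_cast)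
    rw [contMDiffAt_iff_contMDiffAt_nhds (by simp)] at h
    exact h.mono fun q hq ↦ hq.mdifferentiableAt (by norm_num)
  have hfZ : CMDiffAt 2 (T% (f • Z)) p := hf.smul_section hZ
  have hd {W : Π p : M, TangentSpace 𝓘(ℝ, E) p} (hW : CMDiffAt 2 (T% W) p) :
      MDiffAt (T% W) p := hW.mdifferentiableAt (by norm_num)
  have hB {U V : Π p : M, TangentSpace 𝓘(ℝ, E) p} (hU : CMDiffAt 2 (T% U) p)
      (hV : CMDiffAt 2 (T% V) p) : MDiffAt (T% (mlieBracket 𝓘(ℝ, E) U V)) p :=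
    (ContMDiffAt.mlieBracket_vectorField (m := 1) (n := 2) hU hV
        (by simp; norm_num)).mdifferentiableAt (by norm_num)
  have key {U V : Π p : M, TangentSpace 𝓘(ℝ, E) p} (hU : CMDiffAt 2 (T% U) p)
      (hV : CMDiffAt 2 (T% V) p) :
      mlieBracket 𝓘(ℝ, E) U (mlieBracket 𝓘(ℝ, E) V (f • Z)) p
        = mvfderiv 𝓘(ℝ, E) (fun q ↦ mvfderiv 𝓘(ℝ, E) f q (V q)) p (U p) • Z p
          + mvfderiv 𝓘(ℝ, E) f p (V p) • mlieBracket 𝓘(ℝ, E) U Z p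
          + (mvfderiv 𝓘(ℝ, E) f p (U p) • mlieBracket 𝓘(ℝ, E) V Z p
          + f p • mlieBracket 𝓘(ℝ, E) U (mlieBracket 𝓘(ℝ, E) V Z) p) := by
    have e : mlieBracket 𝓘(ℝ, E) V (f • Z) =ᶠ[nhds p]
        (fun q ↦ mvfderiv 𝓘(ℝ, E) f q (V q)) • Z + f • mlieBracket 𝓘(ℝ, E) V Z := by
      filter_upwards [hf', hZ.eventually_mdifferentiableAt] with q h1 h2
      exact mlieBracket_smul_right h1 h2
    have hVf := mdifferentiableAt_mvfderiv_apply hf (hV.of_le (by norm_num))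
    have hfp := hf.mdifferentiableAt (by norm_num)
    have e' := Filter.EventuallyEq.mlieBracket_vectorField_eq (I := 𝓘(ℝ, E)) (V₁ := U)
      Filter.EventuallyEq.rfl e
    refine e'.trans ?_
    rw [mlieBracket_add_right (hVf.smul_section (hd hZ)) (hfp.smul_section (hB hV hZ)),
      mlieBracket_smul_right hVf (hd hZ), mlieBracket_smul_right hfp (hB hV hZ)]
  have J := leibniz_identity_mlieBracket_apply (U := X) (V := Y) (W := f • Z)
    (by simpa using hX) (by simpa using hY) (by simpa using hfZ)
  have J' := leibniz_identity_mlieBracket_apply (U := X) (V := Y) (W := Z)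
    (by simpa using hX) (by simpa using hY) (by simpa using hZ)
  rw [key hX hY, key hY hX, mlieBracket_smul_right (hf.mdifferentiableAt (by norm_num)) (hd hZ),
    J'] at J
  refine smul_left_injective ℝ hZp ?_
  simp only [sub_smul]
  rw [← sub_eq_zero] at J ⊢
  rw [← neg_eq_zero, ← J]
  module

/-- Metric compatibility of the connection, differentiating along a single tangent vector. -/
theorem mvfderiv_val_apply (g : PseudoRiemannianMetric E M)
    {Y Z : Π p : M, TangentSpace 𝓘(ℝ, E) p} {p : M}
    (hY : MDiffAt (T% Y) p) (hZ : MDiffAt (T% Z) p) (x : TangentSpace 𝓘(ℝ, E) p) :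
    mvfderiv 𝓘(ℝ, E) (fun q ↦ g.val q (Y q) (Z q)) p x
      = g.val p (g.leviCivita Y p x) (Z p) + g.val p (Y p) (g.leviCivita Z p x) := by
  have := g.leviCivita_metric (mdifferentiableAt_extend 𝓘(ℝ, E) E x) hY hZ
  rwa [extend_apply_self] at this

theorem mvfderiv_mvfderiv_val (g : PseudoRiemannianMetric E M)
    {X Y Z W : Π p : M, TangentSpace 𝓘(ℝ, E) p} {p : M}
    (hY : CMDiffAt 2 (T% Y) p) (hZ : CMDiffAt 2 (T% Z) p) (hW : CMDiffAt 2 (T% W) p) :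
    mvfderiv 𝓘(ℝ, E) (fun q ↦ mvfderiv 𝓘(ℝ, E) (fun q ↦ g.val q (Z q) (W q)) q (Y q)) p (X p)
      = g.val p (g.leviCivita (fun q ↦ g.leviCivita Z q (Y q)) p (X p)) (W p)
        + g.val p (g.leviCivita Z p (Y p)) (g.leviCivita W p (X p))
        + (g.val p (g.leviCivita Z p (X p)) (g.leviCivita W p (Y p))
        + g.val p (Z p) (g.leviCivita (fun q ↦ g.leviCivita W q (Y q)) p (X p))) := by
  have e : (fun q ↦ mvfderiv 𝓘(ℝ, E) (fun q ↦ g.val q (Z q) (W q)) q (Y q)) =ᶠ[nhds p]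
      fun q ↦ g.val q (g.leviCivita Z q (Y q)) (W q) + g.val q (Z q) (g.leviCivita W q (Y q)) := by
    filter_upwards [hZ.eventually_mdifferentiableAt, hW.eventually_mdifferentiableAt] with q h1 h2
    exact g.mvfderiv_val_apply h1 h2 _
  have dZ := hZ.mdifferentiableAt (by norm_num)
  have dW := hW.mdifferentiableAt (by norm_num)
  have dYZ := g.mdifferentiableAt_leviCivita hY hZ
  have dYW := g.mdifferentiableAt_leviCivita hY hW
  have e3 : mvfderiv 𝓘(ℝ, E) (fun q ↦ g.val q (g.leviCivita Z q (Y q)) (W q)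
      + g.val q (Z q) (g.leviCivita W q (Y q))) p = _ :=
    mvfderiv_add (g.mdifferentiableAt_val dYZ dW) (g.mdifferentiableAt_val dZ dYW)
  rw [mvfderiv_congr_of_eventuallyEq e, e3, add_apply, g.mvfderiv_val_apply dYZ dW,
    g.mvfderiv_val_apply dZ dYW]

/-- `R(X, Y)` is skew for the metric, at the level of fields. -/
theorem val_curvatureField_skew (g : PseudoRiemannianMetric E M)
    {X Y Z W : Π p : M, TangentSpace 𝓘(ℝ, E) p} {p : M}
    (hX : CMDiffAt 2 (T% X) p) (hY : CMDiffAt 2 (T% Y) p)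
    (hZ : CMDiffAt 2 (T% Z) p) (hW : CMDiffAt 2 (T% W) p) :
    g.val p (g.curvatureField X Y Z p) (W p) = - g.val p (Z p) (g.curvatureField X Y W p) := by
  have h := mvfderiv_mlieBracket (g.contMDiffAt_val (n := 2) hZ hW) hX hY
  rw [g.mvfderiv_mvfderiv_val hY hZ hW, g.mvfderiv_mvfderiv_val hX hZ hW,
    g.mvfderiv_val_apply (hZ.mdifferentiableAt (by norm_num))
      (hW.mdifferentiableAt (by norm_num))] at h
  simp only [curvatureField, map_sub, sub_apply]
  linarith

/-- The curvature tensor may be computed from any `C^2` field through the third vector: by skewness,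
`g(R(X, Y)Z, w)` depends on `Z` only through its value at the point. -/
theorem curvature_apply_eq (g : PseudoRiemannianMetric E M)
    {Z : Π p : M, TangentSpace 𝓘(ℝ, E) p} {p : M} (x y : TangentSpace 𝓘(ℝ, E) p)
    (hZ : CMDiffAt 2 (T% Z) p) :
    g.curvature p x y (Z p) = g.curvatureField (extend E x) (extend E y) Z p := by
  refine sub_eq_zero.1 (g.nondegenerate p _ fun w ↦ ?_)
  have hext (z : TangentSpace 𝓘(ℝ, E) p) : CMDiffAt 2 (T% (extend E z)) p := contMDiffAt_extend ..
  have h1 := g.val_curvatureField_skew (hext x) (hext y) hZ (hext w)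
  have h2 := g.val_curvatureField_skew (hext x) (hext y) (hext (Z p)) (hext w)
  rw [extend_apply_self] at h1 h2
  rw [extend_apply_self] at h2
  rw [map_sub, sub_apply, h1]
  exact sub_eq_zero.2 h2

theorem val_curvature_skew (g : PseudoRiemannianMetric E M) (p : M)
    (x y z w : TangentSpace 𝓘(ℝ, E) p) :
    g.val p (g.curvature p x y z) w = - g.val p z (g.curvature p x y w) := by
  have hext (z : TangentSpace 𝓘(ℝ, E) p) : CMDiffAt 2 (T% (extend E z)) p := contMDiffAt_extend ..
  simpa [curvature] using g.val_curvatureField_skew (hext x) (hext y) (hext z) (hext w)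

theorem curvature_add (g : PseudoRiemannianMetric E M) (p : M)
    (x y z w : TangentSpace 𝓘(ℝ, E) p) :
    g.curvature p x y (z + w) = g.curvature p x y z + g.curvature p x y w := by
  refine sub_eq_zero.1 (g.nondegenerate p _ fun u ↦ ?_)
  simp only [map_sub, map_add, sub_apply, add_apply, g.val_curvature_skew]
  ring

theorem curvature_smul (g : PseudoRiemannianMetric E M) (p : M) (c : ℝ)
    (x y z : TangentSpace 𝓘(ℝ, E) p) :
    g.curvature p x y (c • z) = c • g.curvature p x y z := by
  refine sub_eq_zero.1 (g.nondegenerate p _ fun u ↦ ?_)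
  simp only [map_sub, map_smul, sub_apply, smul_apply, g.val_curvature_skew]
  simp

end PseudoRiemannianMetric

/-! ### Nondegenerate planes -/

/-- The Gram determinant of a basis of a nondegenerate plane is nonzero; this is the denominator of
the sectional curvature. -/
theorem PseudoRiemannianMetric.gram_ne_zero_of_isSection {E : Type*} [NormedAddCommGroup E]
    [NormedSpace ℝ E] {M : Type*} [TopologicalSpace M] [ChartedSpace E M]
    [IsManifold 𝓘(ℝ, E) ∞ M] (g : PseudoRiemannianMetric E M) {p : M}
    {β : Submodule ℝ (TangentSpace 𝓘(ℝ, E) p)} (hβ : g.IsSection p β)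
    {x y : TangentSpace 𝓘(ℝ, E) p} (hli : LinearIndependent ℝ ![x, y])
    (hspan : Submodule.span ℝ {x, y} = β) :
    g.val p x x * g.val p y y - g.val p x y ^ 2 ≠ 0 := by
  intro h0
  have hsymm := g.symm p y x
  -- a combination of `x` and `y` orthogonal to both is orthogonal to the plane
  have orth (a b : ℝ) (h1 : a * g.val p x x + b * g.val p x y = 0)
      (h2 : a * g.val p x y + b * g.val p y y = 0) : a = 0 ∧ b = 0 := by
    refine LinearIndependent.pair_iff.1 hli a b (hβ.2 _ ?_ fun z hz ↦ ?_)
    · rw [← hspan]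
      exact Submodule.mem_span_pair.2 ⟨a, b, rfl⟩
    · rw [← hspan] at hz
      obtain ⟨c, d, rfl⟩ := Submodule.mem_span_pair.1 hz
      simp only [map_add, map_smul, add_apply, smul_apply, smul_eq_mul, hsymm]
      linear_combination c * h1 + d * h2
  have k1 := orth (g.val p y y) (- g.val p x y) (by linear_combination h0) (by ring)
  have k2 := orth (g.val p x y) (- g.val p x x) (by ring) (by linear_combination -h0)
  have k3 := orth 1 0 (by linarith [k2.2]) (by linarith [k2.1])
  exact one_ne_zero k3.1

/-! ### Curvature of Sasaki-like structures -/

namespace AlmostContactBMetric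

variable {n : ℕ} {E : Type*} [NormedAddCommGroup E] [NormedSpace ℝ E]
  {M : Type*} [TopologicalSpace M] [ChartedSpace E M] [IsManifold 𝓘(ℝ, E) ∞ M]

theorem eta_eq (S : AlmostContactBMetric n E M) (p : M) (x : TangentSpace 𝓘(ℝ, E) p) :
    S.eta p x = S.g.val p x (S.xi p) := by
  have := S.g_phi_phi p x (S.xi p)
  rw [S.phi_xi, map_zero, S.eta_xi] at this
  linarith

theorem val_phi_left (S : AlmostContactBMetric n E M) (p : M) (x y : TangentSpace 𝓘(ℝ, E) p) :
    S.g.val p (S.phi p x) y = S.g.val p x (S.phi p y) := by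
  have h1 := S.g_phi_phi p x (S.phi p y)
  have h2 := S.eta_phi p x
  rw [S.eta_eq] at h2
  rw [S.phi_phi, S.eta_phi, map_add, map_neg, map_smul, h2] at h1
  simpa using h1

theorem contMDiffAt_phi_apply (S : AlmostContactBMetric n E M)
    {Z : Π p : M, TangentSpace 𝓘(ℝ, E) p} {p : M} (hZ : CMDiffAt 2 (T% Z) p) :
    CMDiffAt 2 (T% (fun q ↦ S.phi q (Z q))) p :=
  ContMDiffAt.clm_bundle_apply (b := fun q : M ↦ q)
    ((S.contMDiff_phi p).of_le (by norm_cast)) hZ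

theorem mdifferentiableAt_phi_apply (S : AlmostContactBMetric n E M)
    {Z : Π p : M, TangentSpace 𝓘(ℝ, E) p} {p : M} (hZ : MDiffAt (T% Z) p) :
    MDiffAt (T% (fun q ↦ S.phi q (Z q))) p :=
  MDifferentiableAt.clm_bundle_apply (b := fun q : M ↦ q)
    ((S.contMDiff_phi p).mdifferentiableAt (by simp)) hZ

variable [FiniteDimensional ℝ E]

/-- The Sasaki-like identity for arbitrary differentiable fields `Z`, by tensoriality of
`Z ↦ ∇_x(φZ) - φ(∇_x Z)`. -/
theorem IsSasakiLike.leviCivita_phi {S : AlmostContactBMetric n E M} (hS : S.IsSasakiLike)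
    {Z : Π p : M, TangentSpace 𝓘(ℝ, E) p} {p : M} (hZ : MDiffAt (T% Z) p)
    (x : TangentSpace 𝓘(ℝ, E) p) :
    S.g.leviCivita (fun q ↦ S.phi q (Z q)) p x
      = S.phi p (S.g.leviCivita Z p x)
        + (2 * S.eta p x * S.eta p (Z p) - S.g.val p x (Z p)) • S.xi p - S.eta p (Z p) • x := by
  have : IsManifold 𝓘(ℝ, E) 1 M := IsManifold.of_le (n := ∞) (by norm_cast)
  have hT : TensorialAt 𝓘(ℝ, E) E (fun Z : Π p : M, TangentSpace 𝓘(ℝ, E) p ↦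
      S.g.leviCivita (fun q ↦ S.phi q (Z q)) p x - S.phi p (S.g.leviCivita Z p x)) p :=
    { smul := by
        intro f Z hf hZ
        have h1 : (fun q ↦ S.phi q ((f • Z) q)) = f • fun q ↦ S.phi q (Z q) := by
          ext q; simp
        rw [h1, S.g.leviCivita.isCovariantDerivativeOnUniv.leibniz
          (S.mdifferentiableAt_phi_apply hZ) hf,
          S.g.leviCivita.isCovariantDerivativeOnUniv.leibniz hZ hf]
        simp [smul_sub]
      add := by
        intro Z Z' hZ hZ'
        have h1 : (fun q ↦ S.phi q ((Z + Z') q))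
            = (fun q ↦ S.phi q (Z q)) + fun q ↦ S.phi q (Z' q) := by
          ext q; simp
        rw [h1, S.g.leviCivita.isCovariantDerivativeOnUniv.add
          (S.mdifferentiableAt_phi_apply hZ) (S.mdifferentiableAt_phi_apply hZ'),
          S.g.leviCivita.isCovariantDerivativeOnUniv.add hZ hZ']
        simp only [add_apply, map_add]
        abel }
  have h := hT.pointwise hZ (mdifferentiableAt_extend 𝓘(ℝ, E) E (Z p)) (by simp)
  have h' := hS p x (Z p)
  rw [PseudoRiemannianMetric.covDerivEnd] at h'
  rw [h', sub_eq_iff_eq_add] at h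
  rw [h]
  module

/-- The Sasaki-like identity applied to `ξ` gives `φ(∇_x ξ) = φ(-φx)`, and both `∇_x ξ` and `φx` are
horizontal. -/
theorem IsSasakiLike.leviCivita_xi {S : AlmostContactBMetric n E M} (hS : S.IsSasakiLike)
    (p : M) (x : TangentSpace 𝓘(ℝ, E) p) :
    S.g.leviCivita S.xi p x = - S.phi p x := by
  have dxi : MDiffAt (T% S.xi) p := (S.contMDiff_xi p).mdifferentiableAt (by simp)
  -- `ξ` has constant length, so that `∇_x ξ` is horizontal
  have h1 : S.eta p (S.g.leviCivita S.xi p x) = 0 := by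
    have h := S.g.mvfderiv_val_apply dxi dxi x
    have hc : (fun q ↦ S.g.val q (S.xi q) (S.xi q)) = fun _ ↦ (1 : ℝ) := by
      ext q; rw [← S.eta_eq, S.eta_xi]
    rw [hc, mvfderiv_const, S.g.symm p (S.xi p), ← S.eta_eq] at h
    simp at h
    linarith
  have h2 := hS.leviCivita_phi dxi x
  have h0 : (fun q ↦ S.phi q (S.xi q)) = 0 := by ext q; exact S.phi_xi q
  rw [h0, CovariantDerivative.zero, S.eta_xi, ← S.eta_eq] at h2
  have h3 := congrArg (S.phi p) h2
  simp only [Pi.zero_apply, zero_apply, map_zero, map_add, map_sub, map_smul, S.phi_phi,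
    S.phi_xi, h1] at h3
  rw [← sub_eq_zero, ← neg_eq_zero, h3]
  module

theorem IsSasakiLike.curvature_xi {S : AlmostContactBMetric n E M} (hS : S.IsSasakiLike)
    (p : M) (x y : TangentSpace 𝓘(ℝ, E) p) :
    S.g.curvature p x y (S.xi p) = S.eta p y • x - S.eta p x • y := by
  have : IsManifold 𝓘(ℝ, E) 1 M := IsManifold.of_le (n := ∞) (by norm_cast)
  rw [S.g.curvature_apply_eq x y ((S.contMDiff_xi p).of_le (by norm_cast))]
  have e (Y : Π p : M, TangentSpace 𝓘(ℝ, E) p) :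
      (fun q ↦ S.g.leviCivita S.xi q (Y q)) = (-1 : ℝ) • fun q ↦ S.phi q (Y q) := by
    ext q; simp [hS.leviCivita_xi]
  have dx := mdifferentiableAt_extend 𝓘(ℝ, E) E x
  have dy := mdifferentiableAt_extend 𝓘(ℝ, E) E y
  have ht := S.g.leviCivita_torsion dx dy
  rw [PseudoRiemannianMetric.curvatureField, e, e, hS.leviCivita_xi, ← ht,
    S.g.leviCivita.isCovariantDerivativeOnUniv.smul_const _ (S.mdifferentiableAt_phi_apply dx),
    S.g.leviCivita.isCovariantDerivativeOnUniv.smul_const _ (S.mdifferentiableAt_phi_apply dy)]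
  simp only [extend_apply_self, smul_apply, map_sub, hS.leviCivita_phi dx, hS.leviCivita_phi dy]
  rw [S.g.symm p y x]
  module

/-- The second covariant derivative of `φZ` at a point where the vectors involved are horizontal. -/
theorem IsSasakiLike.leviCivita_leviCivita_phi {S : AlmostContactBMetric n E M}
    (hS : S.IsSasakiLike) {Y Z : Π p : M, TangentSpace 𝓘(ℝ, E) p} {p : M}
    (hY : CMDiffAt 2 (T% Y) p) (hZ : CMDiffAt 2 (T% Z) p) {x : TangentSpace 𝓘(ℝ, E) p}
    (hx : S.eta p x = 0) (hYp : S.eta p (Y p) = 0) (hZp : S.eta p (Z p) = 0) :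
    S.g.leviCivita (fun q ↦ S.g.leviCivita (fun q ↦ S.phi q (Z q)) q (Y q)) p x
      = S.phi p (S.g.leviCivita (fun q ↦ S.g.leviCivita Z q (Y q)) p x)
        - (S.g.val p x (S.g.leviCivita Z p (Y p)) + S.g.val p (S.g.leviCivita Y p x) (Z p)
          + S.g.val p (Y p) (S.g.leviCivita Z p x)) • S.xi p
        - S.eta p (S.g.leviCivita Z p (Y p)) • x
        + S.g.val p (Y p) (Z p) • S.phi p x
        - (S.eta p (S.g.leviCivita Z p x) - S.g.val p (Z p) (S.phi p x)) • Y p := by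
  have : IsManifold 𝓘(ℝ, E) 1 M := IsManifold.of_le (n := ∞) (by norm_cast)
  have dxi : MDiffAt (T% S.xi) p := (S.contMDiff_xi p).mdifferentiableAt (by simp)
  have dY := hY.mdifferentiableAt (by norm_num)
  have dZ := hZ.mdifferentiableAt (by norm_num)
  have dV := S.g.mdifferentiableAt_leviCivita hY hZ
  have dYZ := S.g.mdifferentiableAt_val dY dZ
  have dYxi := S.g.mdifferentiableAt_val dY dxi
  have dZxi := S.g.mdifferentiableAt_val dZ dxi
  let b : M → ℝ := fun q ↦ - S.g.val q (Z q) (S.xi q)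
  let a : M → ℝ := fun q ↦ 2 * (S.g.val q (Y q) (S.xi q) * S.g.val q (Z q) (S.xi q))
    - S.g.val q (Y q) (Z q)
  have hYxi : S.g.val p (Y p) (S.xi p) = 0 := by rw [← S.eta_eq, hYp]
  have hZxi : S.g.val p (Z p) (S.xi p) = 0 := by rw [← S.eta_eq, hZp]
  have dprod := dYxi.mul dZxi
  have d2 : MDiffAt (fun _ : M ↦ (2 : ℝ)) p := mdifferentiableAt_const
  have da : MDiffAt a p := (d2.mul dprod).sub dYZ
  have db : MDiffAt b p := dZxi.neg
  have hda : mvfderiv 𝓘(ℝ, E) a p x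
      = - (S.g.val p (S.g.leviCivita Y p x) (Z p) + S.g.val p (Y p) (S.g.leviCivita Z p x)) := by
    have h1 : mvfderiv 𝓘(ℝ, E) a p = _ := mvfderiv_sub (d2.mul dprod) dYZ
    have h2 : mvfderiv 𝓘(ℝ, E) (fun q ↦ 2 * (S.g.val q (Y q) (S.xi q) * S.g.val q (Z q) (S.xi q)))
      p = _ := mvfderiv_mul d2 dprod
    have h3 : mvfderiv 𝓘(ℝ, E) (fun q ↦ S.g.val q (Y q) (S.xi q) * S.g.val q (Z q) (S.xi q))
      p = _ := mvfderiv_mul dYxi dZxi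
    rw [h1, sub_apply, h2, h3]
    simp only [add_apply, smul_apply, smul_eq_mul, hYxi, hZxi,
      S.g.mvfderiv_val_apply dY dZ, mvfderiv_const, zero_apply]
    ring
  -- the Sasaki-like identity near `p`, as a combination of fields that can be differentiated
  have e : ∀ᶠ q in nhds p, S.g.leviCivita (fun q ↦ S.phi q (Z q)) q (Y q)
      = ((fun q ↦ S.phi q (S.g.leviCivita Z q (Y q))) + a • S.xi + b • Y) q := by
    filter_upwards [hZ.eventually_mdifferentiableAt] with q hq
    rw [hS.leviCivita_phi hq]
    simp only [Pi.add_apply, Pi.smul_apply', a, b, S.eta_eq]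
    module
  have d1 := S.mdifferentiableAt_phi_apply dV
  have d3 : MDiffAt (T% (a • S.xi)) p := da.smul_section dxi
  have d4 : MDiffAt (T% (b • Y)) p := db.smul_section dY
  have d13 := mdifferentiableAt_add_section d1 d3
  have cov := S.g.leviCivita.isCovariantDerivativeOnUniv
  rw [cov.congr_of_eventuallyEq (S.g.mdifferentiableAt_leviCivita hY (S.contMDiffAt_phi_apply hZ))
    (mdifferentiableAt_add_section d13 d4) Filter.univ_mem e, cov.add d13 d4, cov.add d1 d3,
    cov.leibniz dxi da, cov.leibniz dY db]
  have hdb : mvfderiv 𝓘(ℝ, E) b p x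
      = - (S.eta p (S.g.leviCivita Z p x) - S.g.val p (Z p) (S.phi p x)) := by
    have h1 : mvfderiv 𝓘(ℝ, E) b p = _ := mvfderiv_neg
    rw [h1, neg_apply, S.g.mvfderiv_val_apply dZ dxi, hS.leviCivita_xi, S.eta_eq,
      map_neg, sub_eq_add_neg]
  have hbp : b p = 0 := by simp [b, hZxi]
  have hap : a p = - S.g.val p (Y p) (Z p) := by simp [a, hYxi]
  simp only [add_apply, smul_apply, hdb, ContinuousLinearMap.smulRight_apply, hda,
    hS.leviCivita_phi dV, hS.leviCivita_xi, hx, hap, hbp]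
  module

/-- The Ricci identity for the Sasaki-like expression of `∇φ`, on horizontal vectors. -/
theorem IsSasakiLike.curvature_phi {S : AlmostContactBMetric n E M} (hS : S.IsSasakiLike)
    {p : M} {x y z : TangentSpace 𝓘(ℝ, E) p}
    (hx : S.eta p x = 0) (hy : S.eta p y = 0) (hz : S.eta p z = 0) :
    S.g.curvature p x y (S.phi p z) = S.phi p (S.g.curvature p x y z)
      + S.g.val p y z • S.phi p x - S.g.val p x z • S.phi p y
      + S.g.val p z (S.phi p x) • y - S.g.val p z (S.phi p y) • x := by
  have hext (z : TangentSpace 𝓘(ℝ, E) p) : CMDiffAt 2 (T% (extend E z)) p := contMDiffAt_extend ..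
  have d (z : TangentSpace 𝓘(ℝ, E) p) := mdifferentiableAt_extend 𝓘(ℝ, E) E z
  have h0 := S.g.curvature_apply_eq x y (S.contMDiffAt_phi_apply (hext z))
  rw [extend_apply_self] at h0
  have ht := S.g.leviCivita_torsion (d x) (d y)
  rw [h0, PseudoRiemannianMetric.curvature]
  simp only [PseudoRiemannianMetric.curvatureField, extend_apply_self] at ht ⊢
  rw [hS.leviCivita_leviCivita_phi (hext y) (hext z) hx (by simpa) (by simpa),
    hS.leviCivita_leviCivita_phi (hext x) (hext z) hy (by simpa) (by simpa),
    hS.leviCivita_phi (d z), ← ht]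
  simp only [extend_apply_self, map_sub, sub_apply, hz]
  module

/-! ### Sectional curvatures of Sasaki-like structures -/

theorem IsSasakiLike.sectionalCurvature_of_isPhiHolomorphic {S : AlmostContactBMetric n E M}
    (hS : S.IsSasakiLike) {p : M} {β : Submodule ℝ (TangentSpace 𝓘(ℝ, E) p)}
    (hβ : S.g.IsSection p β) (hphi : S.IsPhiHolomorphic p β) :
    S.g.HasSectionalCurvature p β (-1) := by
  intro x y hli hspan
  have hD := S.g.gram_ne_zero_of_isSection hβ hli hspan
  have hx : x ∈ β := hspan ▸ Submodule.subset_span (by simp)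
  have hy : y ∈ β := hspan ▸ Submodule.subset_span (by simp)
  have heta : ∀ z ∈ β, S.eta p z = 0 := by
    intro z hz
    rw [← hphi] at hz
    obtain ⟨w, -, rfl⟩ := hz
    exact S.eta_phi p w
  have hphix : S.phi p x ∈ β := by
    have : S.phi p x ∈ β.map (S.phi p : TangentSpace 𝓘(ℝ, E) p →ₗ[ℝ] TangentSpace 𝓘(ℝ, E) p) :=
      ⟨x, hx, rfl⟩
    rwa [hphi] at this
  rw [← hspan] at hphix
  obtain ⟨a, b, hab⟩ := Submodule.mem_span_pair.1 hphix
  -- `φx = a x` would give `a ^ 2 = -1`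
  have hb : b ≠ 0 := by
    rintro rfl
    have h2 := S.phi_phi p x
    rw [heta x hx, ← hab] at h2
    simp only [zero_smul, add_zero, map_smul, ← hab] at h2
    have h3 : (a * a + 1) • x = 0 := by
      rw [add_smul, mul_smul, h2]; simp
    rcases smul_eq_zero.1 h3 with h | h
    · nlinarith [mul_self_nonneg a]
    · exact hli.ne_zero 0 h
  have hxx := S.g.val_curvature_skew p x y x x
  rw [S.g.symm p x (S.g.curvature p x y x)] at hxx
  have hxy := S.g.val_curvature_skew p x y x y
  rw [S.g.symm p x (S.g.curvature p x y y)] at hxy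
  have hsymm := S.g.symm p y x
  have key := congrArg (fun v ↦ S.g.val p v x)
    (hS.curvature_phi (heta x hx) (heta y hy) (heta x hx))
  have hyx : S.g.val p x (S.phi p y) = S.g.val p y (S.phi p x) := by
    rw [← S.val_phi_left, S.g.symm]
  have hyx' : S.g.val p (S.phi p y) x = S.g.val p y (S.phi p x) := S.val_phi_left p y x
  simp only [map_add, map_sub, map_smul, add_apply, sub_apply, smul_apply, smul_eq_mul,
    hyx, hyx', S.val_phi_left p (S.g.curvature p x y x) x] at key
  simp only [← hab, S.g.curvature_add, S.g.curvature_smul, map_add, map_smul, add_apply,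
    smul_apply, smul_eq_mul, hsymm] at key
  rw [PseudoRiemannianMetric.sectionalCurvature, PseudoRiemannianMetric.curvature₄, div_eq_iff hD]
  refine mul_left_cancel₀ hb ?_
  linear_combination (1 / 2) * key + (b / 2) * hxy

theorem IsSasakiLike.sectionalCurvature_of_isXiSection {S : AlmostContactBMetric n E M}
    (hS : S.IsSasakiLike) {p : M} {β : Submodule ℝ (TangentSpace 𝓘(ℝ, E) p)}
    (hβ : S.g.IsSection p β) (hxi : S.IsXiSection p β) :
    S.g.HasSectionalCurvature p β 1 := by
  intro x y hli hspan
  have hD := S.g.gram_ne_zero_of_isSection hβ hli hspan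
  have hmem : S.xi p ∈ β := by
    obtain ⟨z, -, hz⟩ := hxi
    exact hz ▸ Submodule.subset_span (by simp)
  rw [← hspan] at hmem
  obtain ⟨a, b, hab⟩ := Submodule.mem_span_pair.1 hmem
  have hne : S.xi p ≠ 0 := by
    intro h
    have := S.eta_xi p
    rw [h, map_zero] at this
    exact zero_ne_one this
  have hsymm := S.g.symm p y x
  have hxx := S.g.val_curvature_skew p x y x x
  rw [S.g.symm p x (S.g.curvature p x y x)] at hxx
  have hxy := S.g.val_curvature_skew p x y x y
  rw [S.g.symm p x (S.g.curvature p x y y)] at hxy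
  have hxi' := hS.curvature_xi p x y
  rw [S.eta_eq, S.eta_eq, ← hab, S.g.curvature_add, S.g.curvature_smul, S.g.curvature_smul] at hxi'
  have kx := congrArg (fun v ↦ S.g.val p v x) hxi'
  have ky := congrArg (fun v ↦ S.g.val p v y) hxi'
  simp only [map_add, map_sub, map_smul, add_apply, sub_apply, smul_apply, smul_eq_mul,
    hsymm] at kx ky
  rw [PseudoRiemannianMetric.sectionalCurvature, PseudoRiemannianMetric.curvature₄, div_eq_iff hD]
  -- the components of `A ξ` along `x` and `y` give `b s = b D` and `a s = a D`
  by_cases hb : b = 0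
  · have ha : a ≠ 0 := by
      rintro rfl
      exact hne (by simp [← hab, hb])
    refine mul_left_cancel₀ ha ?_
    subst hb
    linear_combination a * hxy - ky
  · refine mul_left_cancel₀ hb ?_
    linear_combination kx - a / 2 * hxx

end AlmostContactBMetric

theorem theorem3p5 {E : Type*} [NormedAddCommGroup E] [NormedSpace ℝ E] [FiniteDimensional ℝ E]
    (hE : Module.finrank ℝ E = 3)
    {M : Type*} [TopologicalSpace M] [ChartedSpace E M] [IsManifold 𝓘(ℝ, E) ∞ M]
    (S : AlmostContactBMetric 1 E M) (hS : S.IsSasakiLike)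
    (v : Π p : M, TangentSpace 𝓘(ℝ, E) p)
    (hv : ContMDiff 𝓘(ℝ, E) (𝓘(ℝ, E).prod 𝓘(ℝ, E)) ∞
      (fun p ↦ TotalSpace.mk' E (E := fun p : M ↦ TangentSpace 𝓘(ℝ, E) p) p (v p)))
    (hsol : S.AdmitsRicciLikeSoliton v) :
    (∀ (p : M) (β : Submodule ℝ (TangentSpace 𝓘(ℝ, E) p)),
      S.g.IsSection p β → S.IsPhiHolomorphic p β → S.g.HasSectionalCurvature p β (-1)) ∧
    (∀ (p : M) (β : Submodule ℝ (TangentSpace 𝓘(ℝ, E) p)),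
      S.g.IsSection p β → S.IsXiSection p β → S.g.HasSectionalCurvature p β 1) :=
  ⟨fun _ _ hβ hphi ↦ hS.sectionalCurvature_of_isPhiHolomorphic hβ hphi,
    fun _ _ hβ hxi ↦ hS.sectionalCurvature_of_isXiSection hβ hxi⟩
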